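/- Let $d \ge 0$ and $[d] = \{1,\dots,d\}$. A \emph{building set} on $[d]$ is a collection $\mathcal{B}$ of non-empty subsets of $[d]$ such that $I \cup J \in \mathcal{B}$ whenever $I, J \in \mathcal{B}$ and $I \cap J \neq \emptyset$. For non-empty $I \subseteq [d]$ let $\Delta_I = \mathrm{conv}(e_i : i \in I) \subset \mathbb{R}^d$, where $e_1,\dots,e_d$ is the standard basis. The \emph{nestohedron} of $\mathcal{B}$ is the Minkowski sum $\Delta_{\mathcal{B}} = \sum_{I \in \mathcal{B}} \Delta_I$ (the empty sum being $\{0\}$). A polytope in $\mathbb{R}^d$ is \emph{inscribed} if all its vertices lie on a common (Euclidean) sphere, that is, have the same distance to some point of $\mathbb{R}^d$. For $J \subseteq [d]$ let $\mathcal{B}|_J = \{I \in \mathcal{B} : I \subseteq J\}$, and for $i,j,k \in [d]$ let $n_{i,j}^k(\mathcal{B})$ be the number of $I \in \mathcal{B}$ with $i,j \in I$ and $k \notin I$. (1) Let $\mathcal{B}$ be a building set on $[d]$. The nestohedron $\Delta_{\mathcal{B}}$ is inscribed if and only if for all $J \subseteq [d]$ and all $i,j,k \in J$ the following holds: if $n_{i,j}^k(\mathcal{B}|_J)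 > 0$ and $n_{j,k}^i(\mathcal{B}|_J) > 0$, then $$n_{i,j}^k(\mathcal{B}|_J) = n_{j,k}^i(\mathcal{B}|_J) = n_{i,k}^j(\mathcal{B}|_J).$$ (2) Let $G$ be a simple graph on the vertex set $[d]$, and let $\mathcal{B}(G)$ be its graphical building set, which consists of all non-empty $I \subseteq [d]$ such that the induced subgraph $G[I]$ is connected. Then the graph associahedron $\Delta_{\mathcal{B}(G)}$ is inscribed if and only if $G$ is a disjoint union of complete graphs. -/

import Mathlib

open scoped Pointwise

/-- A building set on `[d]`: a collection of non-empty subsets such that the union of any two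
intersecting members is again a member. -/
structure IsBuildingSet {d : ℕ} (B : Finset (Finset (Fin d))) : Prop where
  nonempty : ∀ I ∈ B, I.Nonempty
  union_mem : ∀ I ∈ B, ∀ J ∈ B, (I ∩ J).Nonempty → I ∪ J ∈ B

/-- The simplex `Δ_I = conv (e_i : i ∈ I)` in `ℝ^d`. -/
def simplexFace {d : ℕ} (I : Finset (Fin d)) : Set (EuclideanSpace ℝ (Fin d)) :=
  convexHull ℝ ((fun i => EuclideanSpace.single i (1 : ℝ)) '' (I : Set (Fin d)))

/-- The Minkowski sum `Δ_B = ∑_{I ∈ B} Δ_I`; the empty sum is the point `{0}`. -/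
noncomputable def nestohedron {d : ℕ} (B : Finset (Finset (Fin d))) :
    Set (EuclideanSpace ℝ (Fin d)) :=
  ∑ I ∈ B, simplexFace I

/-- A polytope is inscribed if all its vertices (extreme points) lie on a common sphere. -/
def IsInscribed {d : ℕ} (P : Set (EuclideanSpace ℝ (Fin d))) : Prop :=
  EuclideanGeometry.Cospherical (P.extremePoints ℝ)

/-- The restriction `B|_J = {I ∈ B : I ⊆ J}`. -/
def restrictTo {d : ℕ} (B : Finset (Finset (Fin d))) (J : Finset (Fin d)) :
    Finset (Finset (Fin d)) :=
  B.filter (fun I => I ⊆ J)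

/-- `nCount B i j k` is `n_{i,j}^k(B)`, the number of `I ∈ B` with `i, j ∈ I` and `k ∉ I`. -/
def nCount {d : ℕ} (B : Finset (Finset (Fin d))) (i j k : Fin d) : ℕ :=
  (B.filter (fun I => i ∈ I ∧ j ∈ I ∧ k ∉ I)).card

open Classical in
/-- The graphical building set: all non-empty `I` for which the induced subgraph `G[I]` is
connected. -/
noncomputable def graphicalBuildingSet {d : ℕ} (G : SimpleGraph (Fin d)) :
    Finset (Finset (Fin d)) :=
  Finset.univ.filter (fun I => I.Nonempty ∧ (G.induce (I : Set (Fin d))).Connected)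

/-- `G` is a disjoint union of complete graphs: the vertex set is partitioned into blocks such
that two distinct vertices are adjacent exactly if they lie in the same block. -/
def IsDisjointUnionOfComplete {V : Type*} (G : SimpleGraph V) : Prop :=
  ∃ s : Setoid V, ∀ u v : V, G.Adj u v ↔ u ≠ v ∧ s u v

/-!
The face of a Minkowski sum in a given direction is the sum of the faces of the summands. Hence the
vertices of `Δ_B` are selected by the rankings of `[d]`: the face of `Δ_I` in a direction with
coefficients ordered by a ranking is `e_x` for the highest ranked `x ∈ I`. Exchanging two elements
`i`, `j` of consecutive rank moves the vertex along `e_i - e_j`, by the number of members that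
contain both and lie in the initial segment `J` ending with them. If this number is positive, the
two vertices are equidistant from `z` exactly if `z_i - z_j` is the difference of the degrees of
`i` and `j` in `B|_J`. Every pair in every `J` occurs in this way, and the exchanges connect all
rankings, so `Δ_B` is inscribed exactly if these degree differences do not depend on `J`. Comparing
`J` with `J \ {k}` turns this independence into the condition on the numbers `n_{i,j}^k`.

For a graph, the condition on `J = {i, j, k}` says that adjacency is transitive. Conversely, in a
disjoint union of complete graphs the degrees of `i` and `j` in `B(G)|_J` agree whenever `i` and `j`
lie in the same component, so the origin is equidistant from all vertices.
-/

section Faces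

variable {E : Type*} [TopologicalSpace E]

theorem toExposed_add [AddCommMonoid E] [Module ℝ E] (l : StrongDual ℝ E) (A B : Set E) :
    l.toExposed (A + B) = l.toExposed A + l.toExposed B := by
  ext x
  constructor
  · rintro ⟨⟨a, ha, b, hb, rfl⟩, hmax⟩
    refine ⟨a, ⟨ha, fun a' ha' => ?_⟩, b, ⟨hb, fun b' hb' => ?_⟩, rfl⟩
    · simpa using hmax _ (Set.add_mem_add ha' hb)
    · simpa using hmax _ (Set.add_mem_add ha hb')
  · rintro ⟨a, ⟨ha, hamax⟩, b, ⟨hb, hbmax⟩, rfl⟩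
    refine ⟨Set.add_mem_add ha hb, ?_⟩
    rintro _ ⟨a', ha', b', hb', rfl⟩
    simpa using add_le_add (hamax a' ha') (hbmax b' hb')

theorem toExposed_finsetSum [AddCommMonoid E] [Module ℝ E] {ι : Type*} (l : StrongDual ℝ E)
    (s : Finset ι) (A : ι → Set E) :
    l.toExposed (∑ i ∈ s, A i) = ∑ i ∈ s, l.toExposed (A i) := by
  classical
  induction s using Finset.induction_on with
  | empty =>
    ext x
    simp +contextual [ContinuousLinearMap.toExposed]
  | insert i s hi ih => rw [Finset.sum_insert hi, Finset.sum_insert hi, toExposed_add, ih]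

variable [AddCommGroup E] [Module ℝ E]

theorem le_of_mem_convexHull {l : StrongDual ℝ E} {s : Set E} {m : ℝ} (h : ∀ x ∈ s, l x ≤ m)
    {x : E} (hx : x ∈ convexHull ℝ s) : l x ≤ m :=
  convexHull_min h (convex_halfSpace_le l.toLinearMap.isLinear m) hx

theorem toExposed_convexHull (l : StrongDual ℝ E) (s : Set E) :
    l.toExposed (convexHull ℝ s) = convexHull ℝ (l.toExposed s) := by
  refine Set.Subset.antisymm ?_ (convexHull_min ?_ ?_)
  · rintro x ⟨hx, hmax⟩
    obtain ⟨ι, t, w, z, hw, hw1, hz, rfl⟩ := (convexHull_eq (R := ℝ) s).subset hx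
    classical
    have hgap : ∀ i ∈ t, 0 ≤ w i * (l (t.centerMass w z) - l (z i)) := fun i hi =>
      mul_nonneg (hw i hi) (sub_nonneg.2 (hmax _ (subset_convexHull ℝ s (hz i hi))))
    have hsum : ∑ i ∈ t, w i * (l (t.centerMass w z) - l (z i)) = 0 := by
      simp only [mul_sub, Finset.sum_sub_distrib, ← Finset.sum_mul, hw1, one_mul]
      simp [Finset.centerMass_eq_of_sum_1 _ _ hw1]
    rw [Finset.sum_eq_zero_iff_of_nonneg hgap] at hsum
    have hface : ∀ i ∈ t, w i ≠ 0 → z i ∈ l.toExposed s := fun i hi hwi => by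
      have hli : l (t.centerMass w z) = l (z i) :=
        sub_eq_zero.1 ((mul_eq_zero.1 (hsum i hi)).resolve_left hwi)
      exact ⟨hz i hi, fun y hy => hli ▸ hmax y (subset_convexHull ℝ s hy)⟩
    rw [← Finset.centerMass_filter_ne_zero]
    refine Finset.centerMass_mem_convexHull _ ?_ ?_ ?_
    · exact fun i hi => hw i (Finset.mem_filter.1 hi).1
    · rw [Finset.sum_filter_ne_zero, hw1]; exact one_pos
    · exact fun i hi => hface i (Finset.mem_filter.1 hi).1 (Finset.mem_filter.1 hi).2
  · rintro x ⟨hx, hmax⟩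
    exact ⟨subset_convexHull ℝ s hx, fun y hy => le_of_mem_convexHull hmax hy⟩
  · exact ContinuousLinearMap.toExposed.isExposed.convex (convex_convexHull ℝ s)

theorem mem_extremePoints_of_toExposed_eq_singleton {l : StrongDual ℝ E} {A : Set E} {p : E}
    (h : l.toExposed A = {p}) : p ∈ A.extremePoints ℝ :=
  exposedPoints_subset_extremePoints <|
    mem_exposedPoints_iff_exposed_singleton.2 fun _ => ⟨l, h.symm⟩

theorem subset_convexHull_of_inter_toExposed_nonempty [IsTopologicalAddGroup E]
    [ContinuousSMul ℝ E] [LocallyConvexSpace ℝ E] [T2Space E] {A s : Set E} (hs : s.Finite)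
    (h : ∀ l : StrongDual ℝ E, (s ∩ l.toExposed A).Nonempty) : A ⊆ convexHull ℝ s := by
  intro x hx
  by_contra hxs
  obtain ⟨l, u, hlu, hux⟩ :=
    geometric_hahn_banach_closed_point (convex_convexHull ℝ s) (hs.isClosed_convexHull ℝ) hxs
  obtain ⟨y, hys, -, hmax⟩ := h l
  exact ((hlu y (subset_convexHull ℝ s hys)).trans hux).not_ge (hmax x hx)

end Faces

section Degree

variable {α : Type*} [DecidableEq α]

/-- The degree of `i` in the hypergraph `B`: the number of members of `B` that contain `i`. -/
def degree (B : Finset (Finset α)) (i : α) : ℕ :=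
  (B.filter fun I => i ∈ I).card

/-- The codegree of `i` and `j` in the hypergraph `B`: the number of members of `B` that contain
both. -/
def codegree (B : Finset (Finset α)) (i j : α) : ℕ :=
  (B.filter fun I => i ∈ I ∧ j ∈ I).card

theorem codegree_comm (B : Finset (Finset α)) (i j : α) : codegree B i j = codegree B j i := by
  simp only [codegree, and_comm]

end Degree

section Vertices

variable {d : ℕ} {α : Type*} [LinearOrder α] {B : Finset (Finset (Fin d))} {c : Fin d → α}

theorem toExposed_simplexFace (l : StrongDual ℝ (EuclideanSpace ℝ (Fin d)))
    (I : Finset (Fin d)) :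
    l.toExposed (simplexFace I) = convexHull ℝ ((fun i => EuclideanSpace.single i (1 : ℝ)) ''
      {i | i ∈ I ∧ ∀ j ∈ I, l (EuclideanSpace.single j 1) ≤ l (EuclideanSpace.single i 1)}) := by
  rw [simplexFace, toExposed_convexHull]
  congr 1
  ext x
  constructor
  · rintro ⟨⟨i, hi, rfl⟩, hmax⟩
    exact ⟨i, ⟨hi, fun j hj => hmax _ ⟨j, hj, rfl⟩⟩, rfl⟩
  · rintro ⟨i, ⟨hi, hmax⟩, rfl⟩
    exact ⟨⟨i, hi, rfl⟩, Set.forall_mem_image.2 hmax⟩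

/-- The initial segment of the ranking `c` that ends at `x`: the elements ranked no higher than
`x`, including `x` itself. -/
def initialSegment {ι : Type*} [Fintype ι] (c : ι → α) (x : ι) : Finset ι :=
  {y | c y ≤ c x}

@[simp]
theorem mem_initialSegment {ι : Type*} [Fintype ι] {c : ι → α} {x y : ι} :
    y ∈ initialSegment c x ↔ c y ≤ c x := by
  simp [initialSegment]

/-- The vertex of the nestohedron of `B` at which the linear functionals whose coefficients are
ordered like `c` are maximal. Each `Δ_I` contributes `e_x` for the highest ranked `x ∈ I`, so the
coordinate at `x` is the degree of `x` in the restriction of `B` to the initial segment of `x`. -/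
noncomputable def rankVertex (B : Finset (Finset (Fin d))) (c : Fin d → α) :
    EuclideanSpace ℝ (Fin d) :=
  WithLp.toLp 2 fun x => (degree (restrictTo B (initialSegment c x)) x : ℝ)

theorem rankVertex_apply (B : Finset (Finset (Fin d))) (c : Fin d → α) (x : Fin d) :
    rankVertex B c x = ((B.filter fun I => x ∈ I ∧ ∀ y ∈ I, c y ≤ c x).card : ℝ) := by
  simp [rankVertex, degree, restrictTo, Finset.filter_filter, Finset.subset_iff, and_comm]

theorem rankVertex_eq_sum (B : Finset (Finset (Fin d))) (c : Fin d → α) :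
    rankVertex B c = ∑ I ∈ B, rankVertex {I} c := by
  ext x
  simp [rankVertex_apply, Finset.filter_singleton, apply_ite Finset.card]

theorem exists_rankVertex_singleton_eq_single {I : Finset (Fin d)} (hI : I.Nonempty)
    (hc : Function.Injective c) :
    ∃ t ∈ I, (∀ x ∈ I, c x ≤ c t) ∧ rankVertex {I} c = EuclideanSpace.single t 1 := by
  obtain ⟨t, ht, hmax⟩ := Finset.exists_max_image I c hI
  refine ⟨t, ht, hmax, ?_⟩
  have htop : ∀ x, (x ∈ I ∧ ∀ y ∈ I, c y ≤ c x) ↔ x = t := fun x =>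
    ⟨fun hx => hc ((hmax x hx.1).antisymm (hx.2 t ht)), by rintro rfl; exact ⟨ht, hmax⟩⟩
  ext x
  simp [rankVertex_apply, Finset.filter_singleton, htop, apply_ite Finset.card]

theorem rankVertex_mem_toExposed_nestohedron (hB : ∀ I ∈ B, I.Nonempty)
    (hc : Function.Injective c) {l : StrongDual ℝ (EuclideanSpace ℝ (Fin d))}
    (hl : ∀ x y, c x ≤ c y → l (EuclideanSpace.single x 1) ≤ l (EuclideanSpace.single y 1)) :
    rankVertex B c ∈ l.toExposed (nestohedron B) := by
  rw [rankVertex_eq_sum, nestohedron, toExposed_finsetSum]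
  refine Set.finsetSum_mem_finsetSum _ _ _ fun I hI => ?_
  obtain ⟨t, ht, hmax, heq⟩ := exists_rankVertex_singleton_eq_single (hB I hI) hc
  rw [heq, toExposed_simplexFace]
  exact subset_convexHull ℝ _ ⟨t, ⟨ht, fun x hx => hl _ _ (hmax x hx)⟩, rfl⟩

theorem toExposed_nestohedron_eq_singleton (hB : ∀ I ∈ B, I.Nonempty)
    (hc : Function.Injective c) {l : StrongDual ℝ (EuclideanSpace ℝ (Fin d))}
    (hl : ∀ x y, l (EuclideanSpace.single x 1) ≤ l (EuclideanSpace.single y 1) ↔ c x ≤ c y) :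
    l.toExposed (nestohedron B) = {rankVertex B c} := by
  rw [rankVertex_eq_sum, nestohedron, toExposed_finsetSum, ← Set.finsetSum_singleton]
  refine Finset.sum_congr rfl fun I hI => ?_
  obtain ⟨t, ht, hmax, heq⟩ := exists_rankVertex_singleton_eq_single (hB I hI) hc
  have hface : {i | i ∈ I ∧ ∀ j ∈ I, c j ≤ c i} = {t} := Set.eq_singleton_iff_unique_mem.2
    ⟨⟨ht, hmax⟩, fun i hi => hc ((hmax i hi.1).antisymm (hi.2 t ht))⟩
  simp only [toExposed_simplexFace, hl, hface, heq, Set.image_singleton, convexHull_singleton]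

theorem exists_strongDual_le_iff (c : Fin d → α) :
    ∃ l : StrongDual ℝ (EuclideanSpace ℝ (Fin d)), ∀ x y,
      l (EuclideanSpace.single x 1) ≤ l (EuclideanSpace.single y 1) ↔ c x ≤ c y := by
  obtain ⟨f⟩ := Order.embedding_from_countable_to_dense (Set.range c) ℝ
  refine ⟨innerSL ℝ (WithLp.toLp 2 fun x => f ⟨c x, x, rfl⟩), fun x y => ?_⟩
  simp [EuclideanSpace.inner_single_right, ← Subtype.coe_le_coe]

theorem rankVertex_mem_extremePoints (hB : ∀ I ∈ B, I.Nonempty) (hc : Function.Injective c) :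
    rankVertex B c ∈ (nestohedron B).extremePoints ℝ := by
  obtain ⟨l, hl⟩ := exists_strongDual_le_iff c
  exact mem_extremePoints_of_toExposed_eq_singleton (toExposed_nestohedron_eq_singleton hB hc hl)

theorem exists_perm_forall_le_of_apply_le (a : Fin d → ℝ) :
    ∃ σ : Equiv.Perm (Fin d), ∀ x y, σ x ≤ σ y → a x ≤ a y :=
  ⟨(Tuple.sort a)⁻¹, fun x y h => by simpa using Tuple.monotone_sort a h⟩

theorem nestohedron_eq_convexHull (hB : ∀ I ∈ B, I.Nonempty) :
    nestohedron B = convexHull ℝ (Set.range fun σ : Equiv.Perm (Fin d) => rankVertex B σ) := by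
  refine (subset_convexHull_of_inter_toExposed_nonempty (Set.finite_range _) fun l => ?_).antisymm
    (convexHull_min ?_ (convex_sum _ fun _ _ => convex_convexHull ℝ _))
  · obtain ⟨σ, hσ⟩ := exists_perm_forall_le_of_apply_le fun x => l (EuclideanSpace.single x 1)
    exact ⟨_, ⟨σ, rfl⟩, rankVertex_mem_toExposed_nestohedron hB σ.injective hσ⟩
  · rintro _ ⟨σ, rfl⟩
    exact (rankVertex_mem_extremePoints hB σ.injective).1

theorem extremePoints_nestohedron (hB : ∀ I ∈ B, I.Nonempty) :
    (nestohedron B).extremePoints ℝ =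
      Set.range fun σ : Equiv.Perm (Fin d) => rankVertex B σ := by
  refine Set.Subset.antisymm ?_ ?_
  · rw [nestohedron_eq_convexHull hB]
    exact extremePoints_convexHull_subset
  · rintro _ ⟨σ, rfl⟩
    exact rankVertex_mem_extremePoints hB σ.injective

end Vertices

section Counting

variable {d : ℕ} {B : Finset (Finset (Fin d))} {J K : Finset (Fin d)} {i j : Fin d}

theorem codegree_restrictTo_pos_iff :
    0 < codegree (restrictTo B J) i j ↔ ∃ I ∈ B, I ⊆ J ∧ i ∈ I ∧ j ∈ I := by
  simp [codegree, restrictTo, Finset.card_pos, Finset.Nonempty, and_assoc]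

theorem codegree_restrictTo_pos_mono (hJK : J ⊆ K) (h : 0 < codegree (restrictTo B J) i j) :
    0 < codegree (restrictTo B K) i j := by
  obtain ⟨I, hI, hIJ, hij⟩ := codegree_restrictTo_pos_iff.1 h
  exact codegree_restrictTo_pos_iff.2 ⟨I, hI, hIJ.trans hJK, hij⟩

theorem nCount_swap (B : Finset (Finset (Fin d))) (i j k : Fin d) :
    nCount B i j k = nCount B j i k := by
  simp only [nCount, and_left_comm]

theorem nCount_restrictTo (B : Finset (Finset (Fin d))) (J : Finset (Fin d)) (i j k : Fin d) :
    nCount (restrictTo B J) i j k = codegree (restrictTo B (J.erase k)) i j := by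
  simp only [nCount, codegree, restrictTo, Finset.filter_filter, Finset.subset_erase]
  congr 2
  grind

theorem degree_eq_degree_erase_add_codegree (B : Finset (Finset (Fin d))) (J : Finset (Fin d))
    (i k : Fin d) : degree (restrictTo B J) i =
      degree (restrictTo B (J.erase k)) i + codegree (restrictTo B J) i k := by
  rw [degree, ← Finset.card_filter_add_card_filter_not (fun I => k ∈ I), add_comm]
  simp only [degree, codegree, restrictTo, Finset.filter_filter, Finset.subset_erase, and_assoc]
  congr 3
  grind

theorem nCount_eq_nCount_iff (B : Finset (Finset (Fin d))) (i j k : Fin d) :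
    nCount B i k j = nCount B j k i ↔ codegree B i k = codegree B j k := by
  have hsplit : ∀ a b : Fin d, codegree B a k =
      (B.filter fun I => a ∈ I ∧ b ∈ I ∧ k ∈ I).card + nCount B a k b := fun a b => by
    rw [codegree, nCount, ← Finset.card_filter_add_card_filter_not (fun I => b ∈ I),
      Finset.filter_filter, Finset.filter_filter]
    simp only [and_assoc, and_comm, and_left_comm]
  rw [hsplit i j, hsplit j i]
  simp only [and_left_comm, add_right_inj]

end Counting

section Edges

variable {α : Type*} [LinearOrder α]

theorem dist_add_smul_single_sub_single_eq_iff {ι : Type*} [Fintype ι] [DecidableEq ι]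
    {u z : EuclideanSpace ℝ ι} {i j : ι} (hij : i ≠ j) (m : ℝ) :
    dist (u + m • (EuclideanSpace.single i 1 - EuclideanSpace.single j 1)) z = dist u z ↔
      m = 0 ∨ z i - z j = u i - u j + m := by
  set e := EuclideanSpace.single i (1 : ℝ) - EuclideanSpace.single j 1
  have hnorm : ‖e‖ ^ 2 = 2 := by
    simp [e, norm_sub_sq_real, EuclideanSpace.inner_single_right, hij, one_add_one_eq_two]
  have hinner : inner ℝ (u - z) e = (u i - z i) - (u j - z j) := by
    simp [e, inner_sub_right, EuclideanSpace.inner_single_right]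
  have hexpand : ‖u + m • e - z‖ ^ 2 =
      ‖u - z‖ ^ 2 + 2 * (m * (u i - u j + m - (z i - z j))) := by
    rw [add_sub_right_comm, norm_add_sq_real, norm_smul, mul_pow, hnorm, real_inner_smul_right,
      hinner, Real.norm_eq_abs, sq_abs]
    ring
  rw [dist_eq_norm, dist_eq_norm, ← sq_eq_sq₀ (norm_nonneg _) (norm_nonneg _), hexpand,
    add_eq_left, mul_eq_zero_iff_left two_ne_zero, mul_eq_zero, sub_eq_zero,
    eq_comm (b := z i - z j)]

section InitialSegment

variable {ι : Type*} {c : ι → α} {i j x : ι}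

theorem lt_or_lt_of_covBy (hc : Function.Injective c) (hij : c i ⋖ c j)
    (hxi : x ≠ i) (hxj : x ≠ j) : c x < c i ∨ c j < c x := by
  rcases lt_or_ge (c x) (c j) with h | h
  · exact Or.inl ((hij.le_of_lt h).lt_of_ne (hc.ne hxi))
  · exact Or.inr (h.lt_of_ne' (hc.ne hxj))

variable [Fintype ι] [DecidableEq ι]

theorem initialSegment_eq_erase_of_covBy (hc : Function.Injective c) (hij : c i ⋖ c j) :
    initialSegment c i = (initialSegment c j).erase j := by
  ext y
  have := hij.lt
  have := lt_or_lt_of_covBy hc hij (x := y)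
  grind [mem_initialSegment]

theorem initialSegment_comp_swap_left (hij : c i < c j) :
    initialSegment (c ∘ Equiv.swap i j) i = initialSegment c j := by
  ext y
  simp only [mem_initialSegment, Function.comp_apply, Equiv.swap_apply_def]
  grind

theorem initialSegment_comp_swap_right (hc : Function.Injective c) (hij : c i ⋖ c j) :
    initialSegment (c ∘ Equiv.swap i j) j = (initialSegment c j).erase i := by
  ext y
  have := hij.lt
  have := lt_or_lt_of_covBy hc hij (x := y)
  simp only [mem_initialSegment, Function.comp_apply, Equiv.swap_apply_def, Finset.mem_erase]
  grind

theorem initialSegment_comp_swap_of_ne (hc : Function.Injective c) (hij : c i ⋖ c j)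
    (hxi : x ≠ i) (hxj : x ≠ j) :
    initialSegment (c ∘ Equiv.swap i j) x = initialSegment c x := by
  ext y
  have := hij.lt
  have := lt_or_lt_of_covBy hc hij hxi hxj
  simp only [mem_initialSegment, Function.comp_apply, Equiv.swap_apply_def]
  grind

end InitialSegment

variable {d : ℕ} {c : Fin d → α} {i j : Fin d}

theorem rankVertex_comp_swap (B : Finset (Finset (Fin d))) (hc : Function.Injective c)
    (hij : c i ⋖ c j) :
    rankVertex B (c ∘ Equiv.swap i j) = rankVertex B c +
      (codegree (restrictTo B (initialSegment c j)) i j : ℝ) •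
        (EuclideanSpace.single i 1 - EuclideanSpace.single j 1) := by
  have hne : i ≠ j := fun h => hij.lt.ne (congrArg c h)
  ext x
  simp only [rankVertex, PiLp.add_apply, PiLp.smul_apply, PiLp.sub_apply, PiLp.single_apply]
  rcases eq_or_ne x i with rfl | hxi
  · rw [initialSegment_comp_swap_left hij.lt, initialSegment_eq_erase_of_covBy hc hij,
      degree_eq_degree_erase_add_codegree B (initialSegment c j) x j]
    simp [hne]
  rcases eq_or_ne x j with rfl | hxj
  · rw [initialSegment_comp_swap_right hc hij,
      degree_eq_degree_erase_add_codegree B (initialSegment c x) x i, codegree_comm _ i]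
    simp [hxi]
  · simp [initialSegment_comp_swap_of_ne hc hij hxi hxj, hxi, hxj]

theorem dist_rankVertex_comp_swap_eq_iff (B : Finset (Finset (Fin d)))
    (hc : Function.Injective c) (hij : c i ⋖ c j) (z : EuclideanSpace ℝ (Fin d)) :
    dist (rankVertex B (c ∘ Equiv.swap i j)) z = dist (rankVertex B c) z ↔
      (0 < codegree (restrictTo B (initialSegment c j)) i j →
        z i - z j = (degree (restrictTo B (initialSegment c j)) i : ℝ) -
          degree (restrictTo B (initialSegment c j)) j) := by
  have hne : i ≠ j := fun h => hij.lt.ne (congrArg c h)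
  have hdeg : rankVertex B c i - rankVertex B c j +
      codegree (restrictTo B (initialSegment c j)) i j =
        (degree (restrictTo B (initialSegment c j)) i : ℝ) -
          degree (restrictTo B (initialSegment c j)) j := by
    simp only [rankVertex, initialSegment_eq_erase_of_covBy hc hij,
      degree_eq_degree_erase_add_codegree B (initialSegment c j) i j]
    push_cast
    ring
  rw [rankVertex_comp_swap B hc hij, dist_add_smul_single_sub_single_eq_iff hne, hdeg,
    Nat.cast_eq_zero, pos_iff_ne_zero, or_iff_not_imp_left]

end Edges

section Inscribed

variable {d : ℕ}

theorem eq_of_forall_apply_mul_swap_eq {β : Type*} {F : Equiv.Perm (Fin d) → β}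
    (hF : ∀ σ : Equiv.Perm (Fin d), ∀ i j, σ i ⋖ σ j → F (σ * Equiv.swap i j) = F σ)
    (σ : Equiv.Perm (Fin d)) : F σ = F 1 := by
  cases d with
  | zero => rw [Subsingleton.elim σ 1]
  | succ n =>
    have hσ : σ ∈ Submonoid.closure (Set.range fun i : Fin n => Equiv.swap i.castSucc i.succ) :=
      Equiv.Perm.mclosure_swap_castSucc_succ n ▸ Submonoid.mem_top σ
    induction hσ using Submonoid.closure_induction_left with
    | one => rfl
    | mul_left s hs τ _ ih =>
      obtain ⟨k, rfl⟩ := hs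
      rw [← ih, ← hF τ (τ⁻¹ k.castSucc) (τ⁻¹ k.succ) (by simp [Fin.covBy_iff])]
      simp [Equiv.mul_swap_eq_swap_mul]

theorem exists_injective_covBy_initialSegment_eq {J : Finset (Fin d)} {i j : Fin d} (hi : i ∈ J)
    (hj : j ∈ J) (hij : i ≠ j) :
    ∃ c : Fin d → ℕ, Function.Injective c ∧ c i ⋖ c j ∧ initialSegment c j = J := by
  -- `J \ {i, j}` is ranked below `d`, then come `i` and `j`, then the complement of `J`.
  refine ⟨fun x => if x = i then d else if x = j then d + 1 else
    if x ∈ J then x else d + 2 + x, fun x y h => ?_, ?_, ?_⟩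
  · ext
    grind
  · simp [hij.symm]
  · ext x
    simp only [mem_initialSegment]
    grind

/-- `z` is a degree potential of `B` if, for every restriction `B|_J`, its differences along pairs
contained in a common member are the differences of degrees. These are the centers of the spheres
through all vertices of the nestohedron. -/
def IsDegreePotential (B : Finset (Finset (Fin d))) (z : Fin d → ℝ) : Prop :=
  ∀ J : Finset (Fin d), ∀ i j, 0 < codegree (restrictTo B J) i j →
    z i - z j = (degree (restrictTo B J) i : ℝ) - degree (restrictTo B J) j

theorem isInscribed_nestohedron_iff_exists_isDegreePotential {B : Finset (Finset (Fin d))}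
    (hB : ∀ I ∈ B, I.Nonempty) :
    IsInscribed (nestohedron B) ↔ ∃ z : Fin d → ℝ, IsDegreePotential B z := by
  constructor
  · rintro ⟨z, r, hr⟩
    refine ⟨z, fun J i j hpos => ?_⟩
    obtain ⟨I, -, hIJ, hi, hj⟩ := codegree_restrictTo_pos_iff.1 hpos
    rcases eq_or_ne i j with rfl | hij
    · rw [sub_self, sub_self]
    obtain ⟨c, hc, hcov, rfl⟩ := exists_injective_covBy_initialSegment_eq (hIJ hi) (hIJ hj) hij
    refine (dist_rankVertex_comp_swap_eq_iff B hc hcov z).1 ?_ hpos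
    rw [hr _ (rankVertex_mem_extremePoints hB hc),
      hr _ (rankVertex_mem_extremePoints hB (hc.comp (Equiv.swap i j).injective))]
  · rintro ⟨z, hz⟩
    refine ⟨WithLp.toLp 2 z, dist (rankVertex B (1 : Equiv.Perm (Fin d))) (WithLp.toLp 2 z), ?_⟩
    rw [extremePoints_nestohedron hB, Set.forall_mem_range]
    refine eq_of_forall_apply_mul_swap_eq fun σ i j hij => ?_
    exact (dist_rankVertex_comp_swap_eq_iff B σ.injective hij _).2 (hz _ i j)

end Inscribed

section Balanced

variable {d : ℕ} {B : Finset (Finset (Fin d))}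

/-- `B` is balanced if, in every restriction `B|_J`, two elements `i`, `j` that occur together in
a member avoiding `k` satisfy `n_{i,k}^j = n_{j,k}^i`. The condition relating all three numbers
`n_{i,j}^k`, `n_{j,k}^i`, `n_{i,k}^j` consists of the instances of this one for the permutations of
`i`, `j`, `k`. -/
def IsBalanced (B : Finset (Finset (Fin d))) : Prop :=
  ∀ J : Finset (Fin d), ∀ i j k, 0 < nCount (restrictTo B J) i j k →
    nCount (restrictTo B J) i k j = nCount (restrictTo B J) j k i

theorem mem_and_mem_of_nCount_restrictTo_pos {J : Finset (Fin d)} {i j k : Fin d}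
    (h : 0 < nCount (restrictTo B J) i j k) : i ∈ J ∧ j ∈ J := by
  rw [nCount_restrictTo] at h
  obtain ⟨I, -, hIJ, hi, hj⟩ := codegree_restrictTo_pos_iff.1 h
  exact ⟨Finset.mem_of_mem_erase (hIJ hi), Finset.mem_of_mem_erase (hIJ hj)⟩

theorem isBalanced_iff :
    IsBalanced B ↔ ∀ J : Finset (Fin d), ∀ i ∈ J, ∀ j ∈ J, ∀ k ∈ J,
      0 < nCount (restrictTo B J) i j k → 0 < nCount (restrictTo B J) j k i →
        nCount (restrictTo B J) i j k = nCount (restrictTo B J) j k i ∧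
        nCount (restrictTo B J) j k i = nCount (restrictTo B J) i k j := by
  constructor
  · intro h J i _ j _ k _ hijk hjki
    have hki := h J i j k hijk
    have hij := h J j k i hjki
    rw [nCount_swap _ j i, nCount_swap _ k i] at hij
    exact ⟨hij.trans hki, hki.symm⟩
  · intro h J i j k hijk
    obtain ⟨hi, hj⟩ := mem_and_mem_of_nCount_restrictTo_pos hijk
    rcases (nCount (restrictTo B J) j k i).eq_zero_or_pos with hjki | hjki
    · rcases (nCount (restrictTo B J) i k j).eq_zero_or_pos with hikj | hikj
      · rw [hikj, hjki]
      · rw [nCount_swap] at hijk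
        exact (h J j hj i hi k (mem_and_mem_of_nCount_restrictTo_pos hikj).2 hijk hikj).2
    · exact (h J i hi j hj k (mem_and_mem_of_nCount_restrictTo_pos hjki).2 hijk hjki).2.symm

theorem degree_sub_degree_erase_eq_iff (B : Finset (Finset (Fin d))) (J : Finset (Fin d))
    (i j k : Fin d) :
    (degree (restrictTo B (J.erase k)) i - degree (restrictTo B (J.erase k)) j : ℝ) =
        degree (restrictTo B J) i - degree (restrictTo B J) j ↔
      nCount (restrictTo B J) i k j = nCount (restrictTo B J) j k i := by
  rw [nCount_eq_nCount_iff, degree_eq_degree_erase_add_codegree B J i k,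
    degree_eq_degree_erase_add_codegree B J j k, ← Nat.cast_inj (R := ℝ)]
  push_cast
  constructor <;> intro h <;> linarith

theorem IsDegreePotential.isBalanced {z : Fin d → ℝ} (hz : IsDegreePotential B z) :
    IsBalanced B := by
  intro J i j k h
  rw [nCount_restrictTo] at h
  rw [← degree_sub_degree_erase_eq_iff, ← hz _ i j h,
    ← hz _ i j (codegree_restrictTo_pos_mono (J.erase_subset k) h)]

theorem IsBalanced.degree_sub_degree_union (hB : IsBalanced B) {J : Finset (Fin d)}
    {i j : Fin d} (hJ : 0 < codegree (restrictTo B J) i j) (K : Finset (Fin d)) :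
    (degree (restrictTo B (J ∪ K)) i - degree (restrictTo B (J ∪ K)) j : ℝ) =
      degree (restrictTo B J) i - degree (restrictTo B J) j := by
  induction K using Finset.induction_on with
  | empty => rw [Finset.union_empty]
  | insert k K _ ih =>
    rw [Finset.union_insert]
    by_cases hk : k ∈ J ∪ K
    · rw [Finset.insert_eq_of_mem hk, ih]
    have herase : (insert k (J ∪ K)).erase k = J ∪ K := Finset.erase_insert hk
    have hpos : 0 < nCount (restrictTo B (insert k (J ∪ K))) i j k := by
      rw [nCount_restrictTo, herase]
      exact codegree_restrictTo_pos_mono Finset.subset_union_left hJ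
    have hstep := (degree_sub_degree_erase_eq_iff B _ i j k).2 (hB _ i j k hpos)
    rw [← hstep, herase, ih]

theorem exists_isDegreePotential_iff_isBalanced :
    (∃ z, IsDegreePotential B z) ↔ IsBalanced B := by
  refine ⟨fun ⟨z, hz⟩ => hz.isBalanced, fun hB => ?_⟩
  refine ⟨fun x => degree (restrictTo B Finset.univ) x, fun J i j hJ => ?_⟩
  simpa only [Finset.union_eq_right.2 J.subset_univ] using
    hB.degree_sub_degree_union hJ Finset.univ

end Balanced

theorem isInscribed_nestohedron_iff_isBalanced {d : ℕ} {B : Finset (Finset (Fin d))}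
    (hB : ∀ I ∈ B, I.Nonempty) : IsInscribed (nestohedron B) ↔ IsBalanced B :=
  (isInscribed_nestohedron_iff_exists_isDegreePotential hB).trans
    exists_isDegreePotential_iff_isBalanced

section Graphs

theorem rel_of_reachable {V : Type*} {G : SimpleGraph V} {s : Setoid V}
    (hs : ∀ u v, G.Adj u v → s u v) {u v : V} (huv : G.Reachable u v) : s u v := by
  obtain ⟨p⟩ := huv
  induction p with
  | nil => exact s.refl _
  | cons hadj _ ih => exact s.trans (hs _ _ hadj) ih

theorem induce_connected_iff_of_adj_iff {V : Type*} {G : SimpleGraph V} {s : Setoid V}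
    (hs : ∀ u v, G.Adj u v ↔ u ≠ v ∧ s u v) {S : Set V} :
    (G.induce S).Connected ↔ S.Nonempty ∧ ∀ u ∈ S, ∀ v ∈ S, s u v := by
  rw [SimpleGraph.connected_iff, Set.nonempty_coe_sort, and_comm]
  refine and_congr_right fun _ => ⟨fun h u hu v hv => ?_, fun h u v => ?_⟩
  · exact rel_of_reachable (fun a b hab => ((hs a b).1 hab).2)
      ((h ⟨u, hu⟩ ⟨v, hv⟩).map (SimpleGraph.Embedding.induce S).toHom)
  · rcases eq_or_ne u v with rfl | huv
    · rfl
    · exact SimpleGraph.Adj.reachable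
        ((hs u v).2 ⟨Subtype.coe_ne_coe.2 huv, h u u.2 v v.2⟩)

theorem isDisjointUnionOfComplete_of_adj_trans {V : Type*} {G : SimpleGraph V}
    (h : ∀ u v w, G.Adj u v → G.Adj v w → u ≠ w → G.Adj u w) : IsDisjointUnionOfComplete G := by
  refine ⟨⟨fun u v => u = v ∨ G.Adj u v, fun u => Or.inl rfl, ?_, ?_⟩, fun u v => ?_⟩
  · rintro u v (rfl | huv)
    exacts [Or.inl rfl, Or.inr huv.symm]
  · rintro u v w (rfl | huv) (rfl | hvw)
    · exact Or.inl rfl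
    · exact Or.inr hvw
    · exact Or.inr huv
    · exact or_iff_not_imp_left.2 (h u v w huv hvw)
  · exact ⟨fun huv => ⟨huv.ne, Or.inr huv⟩, fun ⟨hne, huv⟩ => huv.resolve_left hne⟩

variable {d : ℕ} {G : SimpleGraph (Fin d)}

theorem mem_graphicalBuildingSet {I : Finset (Fin d)} : I ∈ graphicalBuildingSet G ↔
    I.Nonempty ∧ (G.induce (I : Set (Fin d))).Connected := by
  simp only [graphicalBuildingSet, Finset.mem_filter_univ]

theorem codegree_graphicalBuildingSet_pair_pos_iff {i j : Fin d} (hij : i ≠ j) :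
    0 < codegree (restrictTo (graphicalBuildingSet G) {i, j}) i j ↔ G.Adj i j := by
  rw [codegree_restrictTo_pos_iff]
  constructor
  · rintro ⟨I, hI, hsub, hi, hj⟩
    have : Nontrivial (I : Set (Fin d)) := ⟨⟨i, hi⟩, ⟨j, hj⟩, fun h => hij (congrArg Subtype.val h)⟩
    obtain ⟨⟨v, hv⟩, hadj⟩ :=
      (mem_graphicalBuildingSet.1 hI).2.preconnected.exists_adj_of_nontrivial ⟨i, hi⟩
    have hadj : G.Adj i v := hadj
    have := hsub hv
    grind [hadj.ne]
  · intro hadj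
    refine ⟨{i, j}, mem_graphicalBuildingSet.2 ⟨Finset.insert_nonempty i {j}, ?_⟩, subset_rfl,
      by simp, by simp⟩
    rw [Finset.coe_pair]
    exact SimpleGraph.induce_pair_connected_of_adj hadj

theorem isDisjointUnionOfComplete_of_isBalanced (hG : IsBalanced (graphicalBuildingSet G)) :
    IsDisjointUnionOfComplete G := by
  refine isDisjointUnionOfComplete_of_adj_trans fun i j k hij hjk hik => ?_
  have hk : ({i, j, k} : Finset (Fin d)).erase k = {i, j} := by grind [hjk.ne]
  have hj : ({i, j, k} : Finset (Fin d)).erase j = {i, k} := by grind [hij.ne, hjk.ne]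
  have hi : ({i, j, k} : Finset (Fin d)).erase i = {j, k} := by grind [hij.ne]
  have h := hG {i, j, k} i j k
  simp only [nCount_restrictTo, hi, hj, hk] at h
  rw [← codegree_graphicalBuildingSet_pair_pos_iff hij.ne] at hij
  rw [← codegree_graphicalBuildingSet_pair_pos_iff hjk.ne] at hjk
  rwa [← codegree_graphicalBuildingSet_pair_pos_iff hik, h hij]

theorem degree_graphicalBuildingSet_of_adj_iff {s : Setoid (Fin d)}
    (hs : ∀ u v, G.Adj u v ↔ u ≠ v ∧ s u v) {J : Finset (Fin d)} {i : Fin d}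
    [DecidablePred (s i)] (hi : i ∈ J) :
    degree (restrictTo (graphicalBuildingSet G) J) i = 2 ^ ((J.filter (s i)).card - 1) := by
  have hmem : {I ∈ restrictTo (graphicalBuildingSet G) J | i ∈ I} =
      Finset.Icc {i} (J.filter (s i)) := by
    ext I
    simp only [restrictTo, Finset.mem_filter, mem_graphicalBuildingSet,
      induce_connected_iff_of_adj_iff hs, Finset.mem_Icc, Finset.singleton_subset_iff]
    constructor
    · rintro ⟨⟨⟨-, -, hI⟩, hIJ⟩, hiI⟩
      exact ⟨hiI, fun x hx => Finset.mem_filter.2 ⟨hIJ hx, hI i hiI x hx⟩⟩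
    · rintro ⟨hiI, hI⟩
      have hrel : ∀ u ∈ I, s i u := fun u hu => (Finset.mem_filter.1 (hI hu)).2
      exact ⟨⟨⟨⟨i, hiI⟩, ⟨i, hiI⟩, fun u hu v hv => s.trans (s.symm (hrel u hu)) (hrel v hv)⟩,
        hI.trans (Finset.filter_subset _ J)⟩, hiI⟩
  rw [degree, hmem, Finset.card_Icc_finset, Finset.card_singleton]
  exact Finset.singleton_subset_iff.2 (Finset.mem_filter.2 ⟨hi, s.refl i⟩)

theorem IsDisjointUnionOfComplete.isDegreePotential_zero (hG : IsDisjointUnionOfComplete G) :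
    IsDegreePotential (graphicalBuildingSet G) 0 := by
  classical
  obtain ⟨s, hs⟩ := hG
  intro J i j hpos
  obtain ⟨I, hI, hIJ, hi, hj⟩ := codegree_restrictTo_pos_iff.1 hpos
  have hconn := (mem_graphicalBuildingSet.1 hI).2
  have hij : s i j := ((induce_connected_iff_of_adj_iff hs).1 hconn).2 i hi j hj
  have hclass : J.filter (s i) = J.filter (s j) :=
    Finset.filter_congr fun x _ => ⟨s.trans (s.symm hij), s.trans hij⟩
  rw [degree_graphicalBuildingSet_of_adj_iff hs (hIJ hi),
    degree_graphicalBuildingSet_of_adj_iff hs (hIJ hj), hclass, sub_self]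
  exact sub_self 0

theorem isInscribed_graphAssociahedron_iff (G : SimpleGraph (Fin d)) :
    IsInscribed (nestohedron (graphicalBuildingSet G)) ↔ IsDisjointUnionOfComplete G := by
  have hne : ∀ I ∈ graphicalBuildingSet G, I.Nonempty := fun I hI =>
    (mem_graphicalBuildingSet.1 hI).1
  rw [isInscribed_nestohedron_iff_isBalanced hne]
  exact ⟨isDisjointUnionOfComplete_of_isBalanced, fun hG => hG.isDegreePotential_zero.isBalanced⟩

end Graphs

theorem mainTheorem8_general (d : ℕ) :
    (∀ B : Finset (Finset (Fin d)), (∀ I ∈ B, I.Nonempty) →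
      (IsInscribed (nestohedron B) ↔
        ∀ J : Finset (Fin d), ∀ i ∈ J, ∀ j ∈ J, ∀ k ∈ J,
          0 < nCount (restrictTo B J) i j k → 0 < nCount (restrictTo B J) j k i →
            nCount (restrictTo B J) i j k = nCount (restrictTo B J) j k i ∧
            nCount (restrictTo B J) j k i = nCount (restrictTo B J) i k j)) ∧
    (∀ G : SimpleGraph (Fin d),
      IsInscribed (nestohedron (graphicalBuildingSet G)) ↔ IsDisjointUnionOfComplete G) :=
  ⟨fun _ hB => (isInscribed_nestohedron_iff_isBalanced hB).trans isBalanced_iff,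
    isInscribed_graphAssociahedron_iff⟩

theorem mainTheorem8 (d : ℕ) :
    (∀ B : Finset (Finset (Fin d)), IsBuildingSet B →
      (IsInscribed (nestohedron B) ↔
        ∀ J : Finset (Fin d), ∀ i ∈ J, ∀ j ∈ J, ∀ k ∈ J,
          0 < nCount (restrictTo B J) i j k → 0 < nCount (restrictTo B J) j k i →
            nCount (restrictTo B J) i j k = nCount (restrictTo B J) j k i ∧
            nCount (restrictTo B J) j k i = nCount (restrictTo B J) i k j)) ∧
    (∀ G : SimpleGraph (Fin d),
      IsInscribed (nestohedron (graphicalBuildingSet G)) ↔ IsDisjointUnionOfComplete G) :=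
  ⟨fun B hB => (mainTheorem8_general d).1 B hB.nonempty, (mainTheorem8_general d).2⟩
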